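/- Theorem (generating function for $k$-ary trees). Let $k,n\ge 1$ be integers and let $T$ be a $k$-ary tree with $n$ levels: $T$ has a root, which forms level $1$; every vertex on a level $j<n$ has exactly $k$ children, all on level $j+1$; and the vertices on level $n$ have no children (so level $j$ has $k^{j-1}$ vertices). Let $G$ be the graph obtained from $T$ by adding one new vertex $0$ joined only to the root of $T$. Let $L_0$ be the Laplacian matrix $D-A$ of $G$ ($D$ the diagonal matrix of degrees, $A$ the adjacency matrix) with the row and column of vertex $0$ deleted, let $N$ be the number of vertices of $T$, let $$\mathcal C=\{x\in\mathbb R^N : L_0x\ge 0\}$$ with the inequality understood componentwise, and let $$\sigma_{\mathcal C}(q)=\sum_{m\in\mathcal C\cap\mathbb Z^N}q^{|m|},\qquad |m|=m_1+\cdots+m_N,$$ as a formal series in $q$. Write $[m]_x=1+x+\cdots+x^{m-1}$ (so $[0]_x=0$). Then this formal sum is well defined as a formal Laurent series (for each $d\in\mathbb Z$ only finitely many $m\in\mathcal C\cap\mathbb Z^N$ have $|m|=d$, and there are none when $d$ is sufficiently negative), and $$\sigma_{\mathcal C}(q)=\frac{1}{\prod_{j=1}^{n}\left(1-q^{\,j[n-j+1]_k+\sum_{i=1}^{j-1}(j-i)k^{n-(j-i)}}\right)^{k^{j-1}}}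 =\frac{1}{\prod_{j=1}^{n}\left(1-q^{\,j[n-j+1]_k+k^{n-j}\left(j([j]_k-1)-k\frac{d}{dk}([j]_k-1)\right)}\right)^{k^{j-1}}},$$ where $\frac{d}{dk}([j]_k-1)$ denotes the derivative of the polynomial $[j]_x-1$ in $x$, evaluated at $x=k$. -/

import Mathlib

/-- The words of length less than `n` over an alphabet of `k` letters. They name the vertices of
the `k`-ary tree with `n` levels: the empty word is the root, and the `k` children of a word `w`
are the words `a :: w`. -/
abbrev KaryWord (k n : ℕ) : Type := {w : List (Fin k) // w.length < n}

/-- The `k`-ary tree with `n` levels: a root, its `k` children, their `k` children each, and so on,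
up to the `n`-th level (the words of length `n - 1`); every vertex is joined to its children. -/
def karyTree (k n : ℕ) : SimpleGraph (KaryWord k n) where
  Adj u v := ∃ a : Fin k, v.1 = a :: u.1 ∨ u.1 = a :: v.1
  symm := ⟨fun _ _ ⟨a, h⟩ => ⟨a, h.symm⟩⟩
  loopless := ⟨by
    rintro u ⟨a, h | h⟩ <;> simpa using congrArg List.length h⟩

/-- `T` is a `k`-ary tree with `n` levels and root `r`: up to the names of the vertices, it is
`karyTree k n` with the empty word as its root. (In particular `n` is positive.) -/
def IsKaryTree {V : Type*} (T : SimpleGraph V) (r : V) (k n : ℕ) : Prop :=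
  ∃ e : T ≃g karyTree k n, (e r).1 = []

/-- The graph obtained from `T` by adding a new vertex `none`, joined to the vertex `r` only. -/
def addLeaf {V : Type*} (T : SimpleGraph V) (r : V) : SimpleGraph (Option V) where
  Adj
    | none, none => False
    | none, some v => v = r
    | some v, none => v = r
    | some u, some v => T.Adj u v
  symm := ⟨by
    rintro (_ | u) (_ | v) h
    · exact h
    · exact h
    · exact h
    · exact T.adj_symm h⟩
  loopless := ⟨by
    rintro (_ | u) h
    · exact h
    · exact T.loopless.irrefl u h⟩

instance {V : Type*} [DecidableEq V] (T : SimpleGraph V) [DecidableRel T.Adj] (r : V) :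
    DecidableRel (addLeaf T r).Adj
  | none, none => inferInstanceAs (Decidable False)
  | none, some v => inferInstanceAs (Decidable (v = r))
  | some v, none => inferInstanceAs (Decidable (v = r))
  | some u, some v => inferInstanceAs (Decidable (T.Adj u v))

/-- The `i`-th Laplacian minor of `G`: its Laplacian matrix with row `i` and column `i` deleted. -/
def laplacianMinor {V : Type*} [Fintype V] [DecidableEq V] (R : Type*) [AddGroupWithOne R]
    (G : SimpleGraph V) [DecidableRel G.Adj] (i : V) : Matrix {v // v ≠ i} {v // v ≠ i} R :=
  (G.lapMatrix R).submatrix Subtype.val Subtype.val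

/-- The cone `{x : A x ≥ 0}` in real space, the inequality being understood componentwise. -/
def matrixCone {ι : Type*} [Fintype ι] (A : Matrix ι ι ℝ) : Set (ι → ℝ) :=
  {x | ∀ i, 0 ≤ (A.mulVec x) i}

/-- The integer points `m` of `C` with `|m| = d`, where `|m|` is the sum of the coordinates. -/
def integerPointsOfSize {ι : Type*} [Fintype ι] (C : Set (ι → ℝ)) (d : ℤ) : Set (ι → ℤ) :=
  {m | (fun i => (m i : ℝ)) ∈ C ∧ ∑ i, m i = d}

/-- The formal sum `∑ q ^ |m|` over all integer points `m` of `C` (the integer point transform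
of `C` with all its variables set equal to `q`) exists as a formal Laurent series in `q`, and it
equals `f`: for every integer `d` only finitely many integer points of `C` have size `d`, and their
number is the coefficient of `q ^ d` in `f`. -/
def IsSpecializedTransform {ι : Type*} [Fintype ι] (C : Set (ι → ℝ)) (f : LaurentSeries ℚ) :
    Prop :=
  ∀ d : ℤ, (integerPointsOfSize C d).Finite ∧ f.coeff d = ((integerPointsOfSize C d).ncard : ℚ)

/-- The formal variable `q`. -/
noncomputable def qVar : LaurentSeries ℚ := HahnSeries.single (1 : ℤ) (1 : ℚ)

/-- `[m]_x = 1 + x + ⋯ + x ^ (m - 1)`, as a polynomial in `x`. -/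
noncomputable def qBracket (m : ℕ) : Polynomial ℤ := ∑ i ∈ Finset.range m, Polynomial.X ^ i

/-- The exponent `j [n-j+1]_k + ∑_{i=1}^{j-1} (j-i) k^{n-(j-i)}` (for `1 ≤ j ≤ n`). -/
noncomputable def sumExponent (k n j : ℕ) : ℤ :=
  (j : ℤ) * (qBracket (n - j + 1)).eval (k : ℤ)
    + ∑ i ∈ Finset.Icc 1 (j - 1), ((j : ℤ) - (i : ℤ)) * (k : ℤ) ^ (n - (j - i))

/-- The exponent `j [n-j+1]_k + k^{n-j} (j ([j]_k - 1) - k (d/dk) ([j]_k - 1))`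
(for `1 ≤ j ≤ n`). -/
noncomputable def closedExponent (k n j : ℕ) : ℤ :=
  (j : ℤ) * (qBracket (n - j + 1)).eval (k : ℤ)
    + (k : ℤ) ^ (n - j) * ((j : ℤ) * ((qBracket j).eval (k : ℤ) - 1)
        - (k : ℤ) * (Polynomial.derivative (qBracket j - 1)).eval (k : ℤ))

/-! Order the edges of `G` from parent to child, counting the new vertex as the parent of the root.
Deleting the row and column of that vertex turns the factorization of the Laplacian by an incidence
matrix into `L₀ = (1 - C)ᵀ (1 - C)` with `C = childMatrix`
(`transpose_mul_one_sub_childMatrix_apply`, `laplacianMinor_addLeaf`). The factor `1 - C` has the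
integer inverse `ancestorMatrix`, so `m ↦ L₀ m` is a bijection from the integer points of the cone
to `ℕ`-valued vectors `y`.

If `c L₀ = (1, …, 1)`, then `|m| = c · y`, and the series is `∏ 1 / (1 - q ^ c_v)`
(`isSpecializedTransform_of_unimodular`). Solving for `c` one factor at a time gives subtree sizes,
then their sums along the path from the root (`pathSize_vecMul`). These depend only on the level,
and level `j` has `k ^ (j - 1)` vertices; the two exponents of the theorem are rewritings of the
path sums. -/

/-! ### Products of geometric series -/

open Finset in
/-- The coefficients of `∏ 1 / (1 - X ^ c i)` count the solutions of `∑ c i * y i = d`. -/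
theorem PowerSeries.coeff_prod_geometric {ι : Type*} [Fintype ι] (c : ι → ℕ) (hc : ∀ i, 0 < c i)
    (d : ℕ) :
    {y : ι → ℕ | ∑ i, c i * y i = d}.Finite ∧
    coeff d (∏ i, (PowerSeries.mk fun m => if c i ∣ m then (1 : ℚ) else 0)) =
      ({y : ι → ℕ | ∑ i, c i * y i = d}.ncard : ℚ) := by
  classical
  -- Scaling by `c` turns solutions into the decompositions of `d` with `i`-th part divisible by `c
  -- i`, which are the terms of the product's coefficient.
  have himg : (fun y i => c i * y i) '' {y : ι → ℕ | ∑ i, c i * y i = d} =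
      (fun l : ι →₀ ℕ => (l : ι → ℕ)) ''
        ((finsuppAntidiag univ d).filter fun l => ∀ i ∈ univ, c i ∣ l i : Finset (ι →₀ ℕ)) := by
    ext l
    simp only [Set.mem_image, Set.mem_ofPred_eq, coe_filter, mem_finsuppAntidiag]
    constructor
    · rintro ⟨y, hy, rfl⟩
      exact ⟨Finsupp.equivFunOnFinite.symm fun i => c i * y i, ⟨⟨by simpa using hy, by simp⟩,
        fun i _ => by simp⟩, by simp⟩
    · rintro ⟨l, ⟨⟨hl, -⟩, hd⟩, rfl⟩
      refine ⟨fun i => l i / c i, ?_, ?_⟩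
      · rw [← hl]
        exact sum_congr rfl fun i hi => Nat.mul_div_cancel' (hd i hi)
      · funext i
        exact Nat.mul_div_cancel' (hd i (mem_univ i))
  have hinj : Function.Injective (fun (y : ι → ℕ) i => c i * y i) := fun y z h =>
    funext fun i => Nat.eq_of_mul_eq_mul_left (hc i) (congrFun h i)
  refine ⟨Set.Finite.of_finite_image (himg ▸ (finite_toSet _).image _) hinj.injOn, ?_⟩
  rw [← Set.ncard_image_of_injective _ hinj, himg,
    Set.ncard_image_of_injective _ DFunLike.coe_injective, Set.ncard_coe_finset, coeff_prod,
    card_filter]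
  push_cast
  refine sum_congr rfl fun l _ => ?_
  simp only [coeff_mk]
  rw [prod_boole]
  congr

/-- `1 / (1 - X ^ c)` is the geometric series. -/
theorem PowerSeries.geometric_mul_one_sub {c : ℕ} (hc : 0 < c) :
    (PowerSeries.mk fun m => if c ∣ m then (1 : ℚ) else 0) * (1 - X ^ c) = 1 := by
  ext m
  rw [mul_sub, mul_one, map_sub, coeff_mul_X_pow', coeff_mk, coeff_one]
  by_cases h : c ≤ m
  · have hm : m ≠ 0 := by omega
    have hd : c ∣ m - c ↔ c ∣ m := by
      rw [Nat.dvd_sub_self_right]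
      exact or_iff_left_of_imp fun hm => le_antisymm h hm ▸ dvd_rfl
    simp [h, hm, coeff_mk, hd]
  · have : c ∣ m ↔ m = 0 :=
      ⟨fun hd => Nat.eq_zero_of_dvd_of_lt hd (by omega), fun hm => hm ▸ dvd_zero c⟩
    simp [h, this]

theorem coeff_inv_prod_one_sub_qVar {ι : Type*} [Fintype ι] (c : ι → ℕ) (hc : ∀ i, 0 < c i)
    (d : ℤ) :
    {y : ι → ℕ | ∑ i, (c i : ℤ) * y i = d}.Finite ∧
    (1 / ∏ i, (1 - qVar ^ c i)).coeff d =
      ({y : ι → ℕ | ∑ i, (c i : ℤ) * y i = d}.ncard : ℚ) := by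
  have hinv : 1 / ∏ i, (1 - qVar ^ c i) =
      ((∏ i, (PowerSeries.mk fun m => if c i ∣ m then (1 : ℚ) else 0) : PowerSeries ℚ) :
        LaurentSeries ℚ) := by
    have h : HahnSeries.ofPowerSeries ℤ ℚ
        (∏ i, (PowerSeries.mk fun m => if c i ∣ m then (1 : ℚ) else 0)) *
        ∏ i, (1 - qVar ^ c i) = 1 := by
      have hq : ∀ i, 1 - qVar ^ c i =
          HahnSeries.ofPowerSeries ℤ ℚ (1 - (PowerSeries.X : PowerSeries ℚ) ^ c i) := by
        intro i
        rw [map_sub, map_one, map_pow, HahnSeries.ofPowerSeries_X, qVar]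
      simp_rw [hq]
      rw [← map_prod, ← map_mul, ← Finset.prod_mul_distrib,
        Finset.prod_congr rfl fun i _ => PowerSeries.geometric_mul_one_sub (hc i)]
      simp
    exact (eq_one_div_of_mul_eq_one_left h).symm
  rw [hinv, PowerSeries.coeff_coe]
  rcases le_or_gt 0 d with hd | hd
  · lift d to ℕ using hd
    have := PowerSeries.coeff_prod_geometric c hc d
    rw [if_neg (by omega), Int.natAbs_natCast]
    convert this using 7 <;> norm_cast
  · have hempty : {y : ι → ℕ | ∑ i, (c i : ℤ) * y i = d} = ∅ := by
      refine Set.eq_empty_of_forall_notMem fun y hy => ?_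
      have : (0 : ℤ) ≤ ∑ i, (c i : ℤ) * y i := Finset.sum_nonneg fun i _ => by positivity
      rw [Set.mem_ofPred_eq] at hy
      omega
    simp [hempty, hd]

/-! ### Integer points of a unimodular cone -/

/-- The cone of an integer matrix `A` with inverse `B`, and a positive vector `c` with
`c A = (1, …, 1)`. -/
theorem isSpecializedTransform_of_unimodular {ι : Type*} [Fintype ι] [DecidableEq ι]
    (A B : Matrix ι ι ℤ) (hAB : A * B = 1) (c : ι → ℕ) (hc : ∀ i, 0 < c i)
    (hcA : Matrix.vecMul (fun i => (c i : ℤ)) A = 1) :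
    IsSpecializedTransform (matrixCone (A.map (Int.cast : ℤ → ℝ)))
      (1 / ∏ i, (1 - qVar ^ c i)) := by
  intro d
  have hBA : B * A = 1 := mul_eq_one_comm.mp hAB
  have hsum : ∀ m : ι → ℤ, ∑ i, m i = ∑ i, (c i : ℤ) * A.mulVec m i := fun m => by
    calc ∑ i, m i = (1 : ι → ℤ) ⬝ᵥ m := by simp [dotProduct]
      _ = (fun i => (c i : ℤ)) ⬝ᵥ A.mulVec m := by rw [← hcA, Matrix.dotProduct_mulVec]
  have hmem : ∀ m : ι → ℤ, (fun i => (m i : ℝ)) ∈ matrixCone (A.map (Int.cast : ℤ → ℝ)) ↔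
      ∀ i, 0 ≤ A.mulVec m i := fun m => by
    refine forall_congr' fun i => ?_
    have : (A.map (Int.cast : ℤ → ℝ)).mulVec (fun i => (m i : ℝ)) i = (A.mulVec m i : ℤ) := by
      simp [Matrix.mulVec, dotProduct]
    rw [this, Int.cast_nonneg_iff]
  have himg : integerPointsOfSize (matrixCone (A.map (Int.cast : ℤ → ℝ))) d =
      (fun y : ι → ℕ => B.mulVec fun i => (y i : ℤ)) ''
        {y : ι → ℕ | ∑ i, (c i : ℤ) * y i = d} := by
    ext m
    simp only [integerPointsOfSize, Set.mem_ofPred_eq, hmem, Set.mem_image]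
    constructor
    · rintro ⟨h0, hm⟩
      have hy : (fun i => ((A.mulVec m i).toNat : ℤ)) = A.mulVec m :=
        funext fun i => Int.toNat_of_nonneg (h0 i)
      refine ⟨fun i => (A.mulVec m i).toNat, ?_, ?_⟩
      · rw [← hm, hsum m]
        exact Finset.sum_congr rfl fun i _ => congrArg _ (congrFun hy i)
      · rw [hy, Matrix.mulVec_mulVec, hBA, Matrix.one_mulVec]
    · rintro ⟨y, hy, rfl⟩
      rw [hsum, Matrix.mulVec_mulVec, hAB, Matrix.one_mulVec]
      exact ⟨fun i => by positivity, hy⟩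
  have hinj : Function.Injective (fun y : ι → ℕ => B.mulVec fun i => (y i : ℤ)) := by
    intro y z h
    have := congrArg A.mulVec h
    simp only [Matrix.mulVec_mulVec, hAB, Matrix.one_mulVec] at this
    exact funext fun i => by exact_mod_cast congrFun this i
  obtain ⟨hfin, hcoeff⟩ := coeff_inv_prod_one_sub_qVar c hc d
  rw [himg, Set.ncard_image_of_injective _ hinj]
  exact ⟨hfin.image _, hcoeff⟩

/-! ### Factorization of the reduced Laplacian -/

noncomputable instance KaryWord.instFintype (k n : ℕ) : Fintype (KaryWord k n) :=
  (List.finite_length_lt (Fin k) n).fintype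

/-- The matrix whose `(u, v)` entry is `1` if `u` is a child of `v`, and `0` otherwise. -/
def childMatrix (k n : ℕ) : Matrix (KaryWord k n) (KaryWord k n) ℤ :=
  Matrix.of fun u v => if ∃ a : Fin k, u.1 = a :: v.1 then 1 else 0

/-- The matrix whose `(u, v)` entry is `1` if `v` is `u` or an ancestor of `u`, and `0`
otherwise. -/
def ancestorMatrix (k n : ℕ) : Matrix (KaryWord k n) (KaryWord k n) ℤ :=
  Matrix.of fun u v => if v.1 <:+ u.1 then 1 else 0

section

variable {k n : ℕ}

theorem sum_childMatrix_nil (h : ([] : List (Fin k)).length < n) (f : KaryWord k n → ℤ) :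
    ∑ v, childMatrix k n ⟨[], h⟩ v * f v = 0 := by
  simp [childMatrix]

theorem sum_childMatrix_cons (a : Fin k) (u : List (Fin k)) (h : (a :: u).length < n)
    (f : KaryWord k n → ℤ) :
    ∑ v, childMatrix k n ⟨a :: u, h⟩ v * f v = f ⟨u, by simp at h; omega⟩ := by
  rw [Finset.sum_eq_single_of_mem ⟨u, by simp at h; omega⟩ (Finset.mem_univ _)]
  · simp [childMatrix]
  · intro v _ hv
    have : u ≠ v.1 := fun h => hv (Subtype.ext h.symm)
    simp [childMatrix, this]

theorem sum_childMatrix_children (v : KaryWord k n) (f : KaryWord k n → ℤ) :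
    ∑ u, childMatrix k n u v * f u =
      if h : v.1.length + 1 < n then ∑ a : Fin k, f ⟨a :: v.1, h⟩ else 0 := by
  simp only [childMatrix, Matrix.of_apply, ite_mul, one_mul, zero_mul]
  rw [← Finset.sum_filter]
  split_ifs with h
  · refine (Finset.sum_of_injOn (fun a : Fin k => (⟨a :: v.1, h⟩ : KaryWord k n)) ?_ ?_ ?_ ?_).symm
    · intro a _ b _ hab
      simpa using hab
    · intro a _
      simp
    · intro u hu hn
      obtain ⟨a, ha⟩ := (Finset.mem_filter.mp hu).2
      exact absurd ⟨a, by simp, Subtype.ext ha.symm⟩ hn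
    · exact fun _ _ => rfl
  · refine Finset.sum_eq_zero fun u hu => ?_
    obtain ⟨a, ha⟩ := (Finset.mem_filter.mp hu).2
    have := u.2
    rw [ha, List.length_cons] at this
    exact absurd this h

/-- Passing from a vertex to its parent loses only the vertex itself from the set of weak ancestors,
so a row of `ancestorMatrix` minus its parent's row is a row of the identity. -/
theorem one_sub_childMatrix_mul_ancestorMatrix :
    (1 - childMatrix k n) * ancestorMatrix k n = 1 := by
  ext ⟨u, hu⟩ w
  rw [sub_mul, one_mul, Matrix.sub_apply, Matrix.mul_apply]
  cases u with
  | nil =>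
    rw [sum_childMatrix_nil]
    simp [ancestorMatrix, Matrix.one_apply, Subtype.ext_iff, eq_comm]
  | cons a u =>
    rw [sum_childMatrix_cons]
    simp only [ancestorMatrix, Matrix.of_apply, List.suffix_cons_iff, Matrix.one_apply,
      Subtype.ext_iff]
    by_cases h : w.1 = a :: u
    · have : ¬ a :: u <:+ u := fun h => by simpa using h.length_le
      simp [h, this]
    · simp [h, Ne.symm h]

/-- The numbers of children and of parents make up the degree. -/
theorem transpose_mul_one_sub_childMatrix_apply (u w : KaryWord k n) :
    ((1 - childMatrix k n).transpose * (1 - childMatrix k n)) u w =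
      (if u = w then (if u.1 = [] then 1 else 0) +
        ∑ v, (childMatrix k n u v + childMatrix k n v u) else 0) -
      (childMatrix k n u w + childMatrix k n w u) := by
  -- Every vertex has one parent, once the root is credited with the new vertex.
  have hone : (if u.1 = [] then 1 else 0) + ∑ v, childMatrix k n u v = 1 := by
    obtain ⟨u, hu⟩ := u
    cases u with
    | nil => simpa using sum_childMatrix_nil hu 1
    | cons a u => simpa using sum_childMatrix_cons a u hu 1
  -- Distinct vertices have no common child.
  have hCC : ((childMatrix k n).transpose * childMatrix k n) u w =
      if u = w then ∑ v, childMatrix k n v u else 0 := by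
    simp only [Matrix.mul_apply, Matrix.transpose_apply]
    split_ifs with h
    · subst h
      exact Finset.sum_congr rfl fun v _ => by simp [childMatrix]
    · refine Finset.sum_eq_zero fun v _ => ?_
      simp only [childMatrix, Matrix.of_apply, mul_ite, mul_one, mul_zero]
      split_ifs with h1 h2 <;> try rfl
      obtain ⟨a, ha⟩ := h1
      obtain ⟨b, hb⟩ := h2
      exact absurd (Subtype.ext (List.cons.inj (hb.symm.trans ha)).2) h
  rw [Matrix.transpose_sub, Matrix.transpose_one, sub_mul, one_mul, mul_sub, mul_one,
    Matrix.sub_apply, Matrix.sub_apply, Matrix.sub_apply, hCC, Matrix.one_apply,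
    Matrix.transpose_apply, Finset.sum_add_distrib, ← add_assoc, hone]
  split_ifs <;> ring

/-! ### Subtree sizes and path sums -/

/-- `[m]_k` as a natural number. -/
def karySize (k m : ℕ) : ℕ := ∑ i ∈ Finset.range m, k ^ i

/-- The sum of the sizes of the subtrees hanging from the first `j` vertices of a path that starts
at the root of the `k`-ary tree with `n` levels. -/
def pathSize (k n j : ℕ) : ℕ := ∑ i ∈ Finset.range j, karySize k (n - i)

/-- A subtree consists of its top vertex and the subtrees of the children: `[m+1]_k = 1 + k [m]_k`.
-/
theorem vecMul_karySize :
    Matrix.vecMul (fun u : KaryWord k n => (karySize k (n - u.1.length) : ℤ))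
      (1 - childMatrix k n) = 1 := by
  funext v
  have hchild := sum_childMatrix_children v fun u => (karySize k (n - u.1.length) : ℤ)
  rw [Matrix.vecMul_sub, Matrix.vecMul_one, Pi.sub_apply, Matrix.vecMul, dotProduct,
    Finset.sum_congr rfl fun u _ => mul_comm _ _, hchild]
  obtain ⟨m, hm⟩ := Nat.exists_eq_add_of_lt v.2
  have h1 : n - v.1.length = m + 1 := by omega
  split_ifs with h
  · have h2 : n - (v.1.length + 1) = m := by omega
    simp only [h1, List.length_cons, h2, Finset.sum_const, Finset.card_univ, Fintype.card_fin,
      nsmul_eq_mul, karySize, Finset.sum_range_succ', pow_succ, ← Finset.sum_mul]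
    push_cast
    simp
    ring
  · have : m = 0 := by omega
    simp [h1, this, karySize]

/-- Subtracting the parent's path sum leaves the last term of the sum. -/
theorem mulVec_pathSize :
    Matrix.mulVec (1 - childMatrix k n)
      (fun u : KaryWord k n => (pathSize k n (u.1.length + 1) : ℤ)) =
      fun u : KaryWord k n => (karySize k (n - u.1.length) : ℤ) := by
  funext ⟨u, hu⟩
  rw [Matrix.sub_mulVec, Matrix.one_mulVec, Pi.sub_apply, Matrix.mulVec, dotProduct]
  cases u with
  | nil =>
    rw [sum_childMatrix_nil]
    simp [pathSize]
  | cons a u =>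
    rw [sum_childMatrix_cons]
    simp [pathSize, Finset.sum_range_succ _ (u.length + 1)]

theorem pathSize_vecMul :
    Matrix.vecMul (fun u : KaryWord k n => (pathSize k n (u.1.length + 1) : ℤ))
      ((1 - childMatrix k n).transpose * (1 - childMatrix k n)) = 1 := by
  rw [← Matrix.vecMul_vecMul, Matrix.vecMul_transpose, mulVec_pathSize, vecMul_karySize]

theorem pathSize_pos {j : ℕ} (hj : 0 < j) (hn : 0 < n) : 0 < pathSize k n j := by
  refine Finset.sum_pos' (fun _ _ => Nat.zero_le _) ⟨0, by simpa using hj, ?_⟩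
  exact Finset.sum_pos' (fun _ _ => Nat.zero_le _) ⟨0, by simpa using hn, by simp⟩

theorem prod_karyWord {M : Type*} [CommMonoid M] (f : ℕ → M) :
    ∏ u : KaryWord k n, f (u.1.length + 1) = ∏ j ∈ Finset.Icc 1 n, f j ^ k ^ (j - 1) := by
  rw [← Finset.prod_fiberwise_of_maps_to (s := Finset.univ) (t := Finset.Icc 1 n)
    (g := fun u : KaryWord k n => u.1.length + 1)
    (fun u _ => Finset.mem_Icc.mpr ⟨by omega, u.2⟩)]
  refine Finset.prod_congr rfl fun j hj => ?_
  rw [Finset.mem_Icc] at hj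
  have hcard : (Finset.univ.filter fun u : KaryWord k n => u.1.length + 1 = j).card =
      k ^ (j - 1) := by
    rw [← Fintype.card_subtype]
    have e : {u : KaryWord k n // u.1.length + 1 = j} ≃ List.Vector (Fin k) (j - 1) :=
      { toFun := fun u => ⟨u.1.1, by have := u.2; omega⟩
        invFun := fun w => ⟨⟨w.1, by have := w.2; omega⟩, by
          have := w.2
          simp only
          omega⟩
        left_inv := fun _ => rfl
        right_inv := fun _ => rfl }
    rw [Fintype.card_congr e, card_vector, Fintype.card_fin]
  rw [← hcard, ← Finset.prod_const]
  exact Finset.prod_congr rfl fun u hu => by rw [(Finset.mem_filter.mp hu).2]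

/-! ### The two formulas for the exponents -/

theorem eval_qBracket (m : ℕ) : (qBracket m).eval (k : ℤ) = karySize k m := by
  simp [qBracket, karySize, Polynomial.eval_finsetSum]

/-- From `j` to `j + 1` the exponent grows by `[n-j]_k`: the new summand `j k^(n-j)` makes up for
replacing `j [n-j+1]_k` by `j [n-j]_k`. -/
theorem sumExponent_eq_pathSize {j : ℕ} (h1 : 1 ≤ j) (hj : j ≤ n) :
    sumExponent k n j = pathSize k n j := by
  -- Substitute `s = j - i`; the extra term `s = 0` vanishes.
  have hsum : ∀ j : ℕ, ∑ i ∈ Finset.Icc 1 (j - 1), ((j : ℤ) - (i : ℤ)) * (k : ℤ) ^ (n - (j - i)) =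
      ∑ s ∈ Finset.range j, (s : ℤ) * (k : ℤ) ^ (n - s) := by
    intro j
    rcases j with _ | j
    · simp
    rw [Finset.sum_range_succ', Nat.add_sub_cancel]
    simp only [CharP.cast_eq_zero, zero_mul, add_zero]
    rw [← Finset.sum_range_reflect, Finset.range_eq_Ico,
      Finset.sum_Ico_eq_sum_range, ← Finset.Ico_add_one_right_eq_Icc, Finset.sum_Ico_eq_sum_range]
    refine Finset.sum_congr (by simp) fun i hi => ?_
    have hi : i < j := by simpa using hi
    have h2 : j - 1 - (0 + i) + 1 = j + 1 - (1 + i) := by omega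
    rw [h2]
    congr 1
    push_cast [show 1 + i ≤ j + 1 by omega]
    ring
  rw [sumExponent, hsum, eval_qBracket]
  clear hsum
  induction j, h1 using Nat.le_induction with
  | base => simp [pathSize, Nat.sub_add_cancel hj]
  | succ j h1 ih =>
    have ih := ih (by omega)
    have hs : (karySize k (n - j + 1) : ℤ) = karySize k (n - j) + k ^ (n - j) := by
      simp [karySize, Finset.sum_range_succ]
    have hp : pathSize k n (j + 1) = pathSize k n j + karySize k (n - j) :=
      Finset.sum_range_succ _ _
    rw [hp, Finset.sum_range_succ, show n - (j + 1) + 1 = n - j by omega]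
    push_cast
    rw [← ih, hs]
    ring

/-- The operator `j - x d/dx` multiplies `x ^ i` by `j - i`, so the sums agree term by term. -/
theorem closedExponent_eq_sumExponent {j : ℕ} (h1 : 1 ≤ j) (hj : j ≤ n) :
    closedExponent k n j = sumExponent k n j := by
  obtain ⟨j, rfl⟩ := Nat.exists_eq_add_of_le' h1
  have hq : qBracket (j + 1) - 1 = ∑ i ∈ Finset.range j, Polynomial.X ^ (i + 1) := by
    simp [qBracket, Finset.sum_range_succ']
  have hb : (qBracket (j + 1)).eval (k : ℤ) - 1 = ∑ i ∈ Finset.range j, (k : ℤ) ^ (i + 1) := by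
    simpa [Polynomial.eval_finsetSum] using congrArg (Polynomial.eval (k : ℤ)) hq
  rw [closedExponent, sumExponent, hb, hq, Nat.add_sub_cancel,
    ← Finset.Ico_add_one_right_eq_Icc, Finset.sum_Ico_eq_sum_range, Nat.add_sub_cancel]
  congr 1
  simp only [Polynomial.derivative_sum, Polynomial.eval_finsetSum, Polynomial.derivative_X_pow]
  rw [Finset.mul_sum, Finset.mul_sum, ← Finset.sum_sub_distrib, Finset.mul_sum]
  refine Finset.sum_congr rfl fun i hi => ?_
  have hi : i < j := Finset.mem_range.mp hi
  rw [show n - (j + 1 - (1 + i)) = n - (j + 1) + (i + 1) by omega, pow_add]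
  simp
  ring

end

/-! ### The Laplacian minor and the main theorem -/

theorem laplacianMinor_map_intCast {V : Type*} [Fintype V] [DecidableEq V]
    (G : SimpleGraph V) [DecidableRel G.Adj] (i : V) :
    laplacianMinor ℝ G i = (laplacianMinor ℤ G i).map Int.cast := by
  ext u v
  simp [laplacianMinor, SimpleGraph.lapMatrix, SimpleGraph.degMatrix, Matrix.diagonal_apply,
    SimpleGraph.adjMatrix_apply, apply_ite (Int.cast : ℤ → ℝ)]

theorem degree_addLeaf {V : Type*} [Fintype V] [DecidableEq V] (T : SimpleGraph V)
    [DecidableRel T.Adj] (r u : V) :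
    ((addLeaf T r).degree (some u) : ℤ) =
      (if u = r then 1 else 0) + ∑ v, if T.Adj u v then 1 else 0 := by
  rw [← SimpleGraph.card_neighborFinset_eq_degree, SimpleGraph.neighborFinset_eq_filter,
    Finset.card_filter, Fintype.sum_option]
  push_cast
  rfl

/-- The adjacency matrix of the `k`-ary tree is the sum of the child matrix and its transpose. -/
theorem ite_karyTree_adj {k n : ℕ} (u v : KaryWord k n) [Decidable ((karyTree k n).Adj u v)] :
    (if (karyTree k n).Adj u v then (1 : ℤ) else 0) = childMatrix k n u v + childMatrix k n v u := by
  have hiff : (karyTree k n).Adj u v ↔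
      (∃ a : Fin k, u.1 = a :: v.1) ∨ ∃ a : Fin k, v.1 = a :: u.1 := by
    rw [← exists_or]
    exact exists_congr fun a => or_comm
  have hne : ¬((∃ a : Fin k, u.1 = a :: v.1) ∧ ∃ a : Fin k, v.1 = a :: u.1) := by
    rintro ⟨⟨a, ha⟩, b, hb⟩
    have h1 := congrArg List.length ha
    have h2 := congrArg List.length hb
    simp only [List.length_cons] at h1 h2
    omega
  simp only [hiff, childMatrix, Matrix.of_apply]
  split_ifs <;> simp_all

/-- The elements of `Option V` other than `none` are the elements of `V`. -/
def someEquiv (V : Type*) : {v : Option V // v ≠ none} ≃ V where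
  toFun v := v.1.get (Option.isSome_iff_ne_none.mpr v.2)
  invFun v := ⟨some v, Option.some_ne_none v⟩
  left_inv v := by simp
  right_inv v := by simp

/-- The edge to the new vertex adds one to the root's degree only, which is exactly the root term on
the diagonal of the factorization. -/
theorem laplacianMinor_addLeaf {k n : ℕ} {V : Type*} [Fintype V] [DecidableEq V]
    (T : SimpleGraph V) [DecidableRel T.Adj] (r : V) (e : T ≃g karyTree k n)
    (he : (e r).1 = []) :
    laplacianMinor ℤ (addLeaf T r) none =
      ((1 - childMatrix k n).transpose * (1 - childMatrix k n)).submatrix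
        ((someEquiv V).trans e.toEquiv) ((someEquiv V).trans e.toEquiv) := by
  classical
  have hadj : ∀ u v : V, (if T.Adj u v then (1 : ℤ) else 0) =
      childMatrix k n (e u) (e v) + childMatrix k n (e v) (e u) := fun u v => by
    simp only [← ite_karyTree_adj, e.map_adj_iff]
  have hroot : ∀ u, u = r ↔ (e u).1 = [] := fun u => by
    rw [← he, ← Subtype.ext_iff, e.injective.eq_iff]
  ext ⟨u, hu⟩ ⟨v, hv⟩
  obtain ⟨u, rfl⟩ := Option.ne_none_iff_exists'.mp hu
  obtain ⟨v, rfl⟩ := Option.ne_none_iff_exists'.mp hv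
  have hA : (addLeaf T r).adjMatrix ℤ (some u) (some v) = if T.Adj u v then 1 else 0 := rfl
  have hdeg : (∑ v, if T.Adj u v then (1 : ℤ) else 0) =
      ∑ w, (childMatrix k n (e u) w + childMatrix k n w (e u)) := by
    simp only [hadj]
    exact e.toEquiv.sum_comp fun w => childMatrix k n (e u) w + childMatrix k n w (e u)
  rw [laplacianMinor, Matrix.submatrix_apply, Matrix.submatrix_apply,
    transpose_mul_one_sub_childMatrix_apply, SimpleGraph.lapMatrix, Matrix.sub_apply, hA,
    SimpleGraph.degMatrix, Matrix.diagonal_apply, degree_addLeaf, hdeg, hadj]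
  simp only [hroot, Option.some_inj]
  change _ = (if e u = e v then _ else _) - _
  simp only [e.injective.eq_iff]
  rfl

theorem mainTheorem3 (k n : ℕ) (hk : 1 ≤ k) {V : Type*} [Fintype V] [DecidableEq V]
    (T : SimpleGraph V) [DecidableRel T.Adj] (r : V) (hT : IsKaryTree T r k n) :
    IsSpecializedTransform (matrixCone (laplacianMinor ℝ (addLeaf T r) none))
      (1 / ∏ j ∈ Finset.Icc 1 n, (1 - qVar ^ sumExponent k n j) ^ k ^ (j - 1)) ∧
    IsSpecializedTransform (matrixCone (laplacianMinor ℝ (addLeaf T r) none))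
      (1 / ∏ j ∈ Finset.Icc 1 n, (1 - qVar ^ closedExponent k n j) ^ k ^ (j - 1)) := by
  obtain ⟨e, he⟩ := hT
  have hn : 0 < n := (Nat.zero_le _).trans_lt (e r).2
  have hclosed : ∏ j ∈ Finset.Icc 1 n, (1 - qVar ^ closedExponent k n j) ^ k ^ (j - 1) =
      ∏ j ∈ Finset.Icc 1 n, (1 - qVar ^ sumExponent k n j) ^ k ^ (j - 1) :=
    Finset.prod_congr rfl fun j hj => by
      rw [closedExponent_eq_sumExponent (Finset.mem_Icc.mp hj).1 (Finset.mem_Icc.mp hj).2]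
  rw [hclosed, and_self]
  let σ := (someEquiv V).trans e.toEquiv
  have hprod : ∏ j ∈ Finset.Icc 1 n, (1 - qVar ^ sumExponent k n j) ^ k ^ (j - 1) =
      ∏ v, (1 - qVar ^ pathSize k n ((σ v).1.length + 1)) := by
    rw [σ.prod_comp fun u : KaryWord k n => 1 - qVar ^ pathSize k n (u.1.length + 1),
      prod_karyWord fun j => 1 - qVar ^ pathSize k n j]
    refine Finset.prod_congr rfl fun j hj => ?_
    rw [sumExponent_eq_pathSize (Finset.mem_Icc.mp hj).1 (Finset.mem_Icc.mp hj).2, zpow_natCast]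
  -- The entries of this inverse count common weak ancestors.
  have hinv : ((1 - childMatrix k n).transpose * (1 - childMatrix k n)) *
      (ancestorMatrix k n * (ancestorMatrix k n).transpose) = 1 := by
    rw [mul_assoc, ← mul_assoc (1 - childMatrix k n), one_sub_childMatrix_mul_ancestorMatrix,
      one_mul, ← Matrix.transpose_mul, mul_eq_one_comm.mp one_sub_childMatrix_mul_ancestorMatrix,
      Matrix.transpose_one]
  rw [hprod, laplacianMinor_map_intCast, laplacianMinor_addLeaf T r e he]
  refine isSpecializedTransform_of_unimodular _
    ((ancestorMatrix k n * (ancestorMatrix k n).transpose).submatrix σ σ) ?_ _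
    (fun v => pathSize_pos (Nat.succ_pos _) hn) ?_
  · rw [Matrix.submatrix_mul_equiv, hinv, Matrix.submatrix_one_equiv]
  · funext v
    have := congrFun (pathSize_vecMul (k := k) (n := n)) (σ v)
    rw [Pi.one_apply] at this ⊢
    rw [← this, Matrix.vecMul, Matrix.vecMul, dotProduct, dotProduct, ← σ.sum_comp]
    rfl
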